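/- \textbf{Definitions.} A finite sequence of vectors $\{\varphi_j\}_{j=1}^n$ in a complex Hilbert space is \emph{equal norm} if $\|\varphi_j\|^2=c$ for all $j$ and some $c>0$; an equal norm sequence is \emph{equiangular} if $|\langle\varphi_j,\varphi_{j'}\rangle|^2$ is constant over $j\neq j'$. It is a \emph{tight frame} for a finite-dimensional space $\mathbb H$ containing it if there is $a>0$ with $\sum_j\langle\varphi_j,y\rangle\varphi_j=ay$ for all $y\in\mathbb H$. An \emph{equiangular tight frame} (ETF) for $\mathbb H$ is an equiangular sequence that is a tight frame for $\mathbb H$. For $s\geq1$, a \emph{regular $s$-simplex} is a sequence of $s+1$ vectors that is an ETF for its span, this span having dimension $s$. A sequence is a \emph{disjoint union of $v$ regular $s$-simplices} if its index set can be partitioned into $v$ subsets of size $s+1$, each of which indexes a regular $s$-simplex. A subset $D$ of a finite abelian group $G$ is a \emph{difference set} if $\#\{(x,y)\in D\times D: g=x-y\}$ is constant over nonzero $g\in G$; the corresponding \emph{harmonic ETF} for $\mathbb C^D\cong\mathbb C^{d}$, $d=|D|$, is the sequence of the restrictions to $D$ of the $n=|G|$ characters of $G$. \textbf{Theorem.}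 Let $q$ be a prime power. There exists an $n$-vector harmonic ETF for $\mathbb C^d$ that is a disjoint union of $v$ regular $s$-simplices in each of the following cases. (a) $d=q^{2f-1}$, $n=\frac{q^{2f}-1}{q-1}$, $v=\frac{q^f-1}{q-1}$, $s=q^f$, for any integer $f\geq2$. The ETF may be taken to arise from the complement of a Singer difference set, that is, of a set $\{\gamma\mathbb F_q^\times:\gamma\in T,\ \gamma\neq0\}$ in $G=\mathbb F_{q^{2f}}^\times/\mathbb F_q^\times$, where $T$ is some $(2f-1)$-dimensional $\mathbb F_q$-subspace of $\mathbb F_{q^{2f}}$. (b) $d=q^e\,\frac{q^{e+1}-1}{q-1}$, $n=q^{e+1}\bigl(1+\frac{q^{e+1}-1}{q-1}\bigr)$, $v=q^{e+1}$, $s=\frac{q^{e+1}-1}{q-1}$, for any integer $e\geq1$. The ETF may be taken to arise from a McFarland difference set, that is, from a set $\{(t_U,u): U \text{ a hyperplane (an } e\text{-dimensional subspace) of } \mathbb F_q^{e+1},\ u\in U\}$ in $G=A\times\mathbb F_q^{e+1}$, where $A$ is some abelian group of order $\frac{q^{e+1}-1}{q-1}+1$ and the elements $t_U\in A$ are distinct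 for distinct $U$. (c) $d=\frac12(q+1)^2$, $n=q(q+2)$, $v=q$, $s=q+1$, provided that $q+2$ is an odd prime power. The ETF may be taken to arise from the complement of the twin prime power difference set, that is, of the set of all $(x,y)$ in $G=\mathbb F_q\times\mathbb F_{q+2}$ such that $y=0$, or $x$ and $y$ are both nonzero squares, or $x$ and $y$ are both nonsquares. -/

import Mathlib

section Frames

variable {ι : Type*} [Fintype ι] {H : Type*} [NormedAddCommGroup H] [InnerProductSpace ℂ H]

/-- Finitely many vectors are equal norm if all of their squared norms equal some `c > 0`. -/
def IsEqualNorm (φ : ι → H) : Prop :=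
  ∃ c : ℝ, 0 < c ∧ ∀ j, ‖φ j‖ ^ 2 = c

/-- An equal norm sequence is equiangular if `|⟨φ j, φ j'⟩|²` is constant over `j ≠ j'`. -/
def IsEquiangular (φ : ι → H) : Prop :=
  IsEqualNorm φ ∧ ∃ w : ℝ, ∀ j j', j ≠ j' → ‖inner ℂ (φ j) (φ j')‖ ^ 2 = w

/-- `φ` is a tight frame for the subspace `W`: its vectors lie in `W`, and its frame operator
is a positive multiple `a` of the identity on `W`. -/
def IsTightFrameFor (φ : ι → H) (W : Submodule ℂ H) : Prop :=
  (∀ j, φ j ∈ W) ∧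
    ∃ a : ℝ, 0 < a ∧ ∀ y ∈ W, ∑ j, (inner ℂ (φ j) y : ℂ) • φ j = (a : ℂ) • y

/-- `φ` is an equiangular tight frame (ETF) for the subspace `W`. -/
def IsETFFor (φ : ι → H) (W : Submodule ℂ H) : Prop :=
  IsEquiangular φ ∧ IsTightFrameFor φ W

/-- A regular `s`-simplex (`s ≥ 1`): a sequence of `s + 1` vectors that is an ETF for its span,
this span having dimension `s`. -/
def IsRegularSimplex (s : ℕ) (φ : Fin (s + 1) → H) : Prop :=
  0 < s ∧ IsETFFor φ (Submodule.span ℂ (Set.range φ)) ∧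
    Module.finrank ℂ (Submodule.span ℂ (Set.range φ)) = s

/-- The sequence `φ` is a disjoint union of `v` regular `s`-simplices: it can be reindexed as
`φ (i, j)` with `i` in `Fin v` and `j` in `Fin (s + 1)` so that each of the `v` subsequences
`φ (i, ·)` is a regular `s`-simplex. -/
def IsDisjointUnionOfSimplices (v s : ℕ) (φ : ι → H) : Prop :=
  ∃ σ : Fin v × Fin (s + 1) ≃ ι, ∀ i, IsRegularSimplex s (fun j => φ (σ (i, j)))

end Frames

section Harmonic

variable {G : Type*} [AddCommGroup G]

/-- A subset `D` of a (finite) abelian group is a difference set if the number of ways to write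
`g` as a difference of two elements of `D` is the same for all `g ≠ 0`. -/
def IsDifferenceSet (D : Set G) : Prop :=
  ∃ l : ℕ, ∀ g : G, g ≠ 0 → {p : G × G | p.1 ∈ D ∧ p.2 ∈ D ∧ g = p.1 - p.2}.ncard = l

/-- `φ` is the sequence of the `n` characters of `G`, restricted to the `d`-element set `D`, after
enumerating the characters and the elements of `D`. (On a finite group every character
`G → ℂ` takes values in the unit circle.) -/
def IsRestrictedCharacters {n d : ℕ} (D : Set G) (φ : Fin n → EuclideanSpace ℂ (Fin d)) : Prop :=
  ∃ (γ : Fin n ≃ AddChar G ℂ) (g : Fin d ≃ D), ∀ j i, φ j i = γ j (g i : G)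

/-- `φ` is the harmonic ETF for `ℂ^d` given by the difference set `D` of the finite abelian
group `G`. -/
def IsHarmonicETF {n d : ℕ} (D : Set G) (φ : Fin n → EuclideanSpace ℂ (Fin d)) : Prop :=
  Finite G ∧ IsDifferenceSet D ∧ IsRestrictedCharacters D φ ∧ IsETFFor φ ⊤

/-- The set `D` yields an `n`-vector harmonic ETF for `ℂ^d` that is a disjoint union of `v`
regular `s`-simplices. -/
def YieldsHarmonicETFOfSimplices (D : Set G) (d n v s : ℕ) : Prop :=
  ∃ φ : Fin n → EuclideanSpace ℂ (Fin d), IsHarmonicETF D φ ∧ IsDisjointUnionOfSimplices v s φ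

end Harmonic

section DifferenceSets

/-- The quotient group `Lˣ / Kˣ` of a field extension `L / K`, written additively. -/
abbrev SingerGroup (K L : Type*) [Field K] [Field L] [Algebra K L] : Type _ :=
  Additive (Lˣ ⧸ (Units.map (algebraMap K L : K →* L)).range)

/-- The set of all classes `γ Kˣ` of nonzero elements `γ` of the subspace `T` of `L`. It is a
Singer difference set if `L` is finite and `T` is a hyperplane. -/
def singerSet (K : Type*) {L : Type*} [Field K] [Field L] [Algebra K L] (T : Submodule K L) :
    Set (SingerGroup K L) :=
  {g | ∃ u : Lˣ, (u : L) ∈ T ∧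
    g = Additive.ofMul (u : Lˣ ⧸ (Units.map (algebraMap K L : K →* L)).range)}

/-- The hyperplanes of the vector space `F^(e+1)`. -/
abbrev Hyperplane (F : Type*) [Field F] (e : ℕ) : Type _ :=
  {U : Submodule F (Fin (e + 1) → F) // Module.finrank F U = e}

/-- All pairs `(t U, u)` where `U` is a hyperplane of `F^(e+1)` and `u` belongs to `U`. It is a
McFarland difference set of `A × F^(e+1)` if `F` is a finite field, the abelian group `A` has one
more element than there are hyperplanes, and `t` is injective. -/
def mcFarlandSet {F : Type*} [Field F] {e : ℕ} {A : Type*} (t : Hyperplane F e → A) :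
    Set (A × (Fin (e + 1) → F)) :=
  {p | ∃ U : Hyperplane F e, p.1 = t U ∧ p.2 ∈ U.1}

/-- All `(x, y)` where `y = 0`, or `x` and `y` are both nonzero squares, or `x` and `y` are both
nonsquares. It is the twin prime power difference set of `K × L` if `K` and `L` are fields of
odd orders `q` and `q + 2`. -/
def twinPrimePowerSet (K L : Type*) [Field K] [Field L] : Set (K × L) :=
  {p | p.2 = 0 ∨ ((p.1 ≠ 0 ∧ IsSquare p.1) ∧ (p.2 ≠ 0 ∧ IsSquare p.2)) ∨
    (¬ IsSquare p.1 ∧ ¬ IsSquare p.2)}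

end DifferenceSets

/-! All three families follow from one criterion, `yieldsHarmonicETFOfSimplices_of_disjoint`. Let
`D` be a difference set of size d in a group of order n, disjoint from a subgroup `H` of order v =
n/(s+1), with s²(n - d) = d(n - 1). The characters trivial on `H` are those of G/H, so there are s+1
of them, and they sum to zero at every point off `H`, in particular on `D`. Their cosets split the n
characters into v blocks of size s+1, and the restrictions to `D` of each block sum to zero.
Distinct restricted characters have inner products of squared modulus d - l, where l(n - 1) = d(d -
1). The parameter identity turns this modulus into d/s. In a block, the s inner products of one
vector with the others sum to -d, which is as negative as their moduli allow. Each is therefore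
-d/s, and the block is a regular simplex (`isRegularSimplex_of_sum_eq_zero`). It remains to supply
difference sets and subgroups that miss them. For (a), take a tower K ⊂ M ⊂ L with [L : M] = 2 and a
hyperplane containing M: the complement of its Singer set misses Mˣ/Kˣ. For (b), let `t` avoid only
0, so that the set misses 0 × F^(e+1). For (c), the complement misses K × 0 because of the clause y
= 0. -/

/-! ### Regular simplices from zero-sum vectors. -/

section Simplices

variable {H : Type*} [NormedAddCommGroup H] [InnerProductSpace ℂ H]

/-- Complex numbers of modulus `r`, one for each of `s` indices, that add up to `-(s * r)` are
all equal to `-r`. -/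
lemma eq_neg_of_sum_eq_neg {ι : Type*} (t : Finset ι) (z : ι → ℂ) {r : ℝ}
    (hz : ∀ j ∈ t, ‖z j‖ = r) (hsum : ∑ j ∈ t, z j = -((t.card : ℂ) * r)) :
    ∀ j ∈ t, z j = -(r : ℂ) := by
  -- Equality case of the triangle inequality: these nonnegative numbers add up to zero.
  have h0 : ∀ j ∈ t, 0 ≤ (z j).re + r := fun j hj => by
    have := (abs_le.1 (Complex.abs_re_le_norm (z j))).1
    rw [hz j hj] at this
    linarith
  have h1 : ∑ j ∈ t, ((z j).re + r) = 0 := by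
    have := congrArg Complex.re hsum
    simp only [Complex.re_sum, Complex.neg_re, Complex.mul_re, Complex.natCast_re,
      Complex.ofReal_re, Complex.natCast_im, zero_mul, sub_zero] at this
    rw [Finset.sum_add_distrib, this, Finset.sum_const, nsmul_eq_mul]
    ring
  intro j hj
  have h2 : (z j).re = -r := by
    linarith [(Finset.sum_eq_zero_iff_of_nonneg h0).1 h1 j hj]
  have h3 : (z j).im = 0 := by
    have := Complex.sq_norm (z j)
    rw [hz j hj, Complex.normSq_apply, h2] at this
    nlinarith
  exact Complex.ext (by simp [h2]) (by simp [h3])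

/-- Vectors of squared norm `d` that add up to zero and whose pairwise inner products have
modulus `d / s` form a regular `s`-simplex. -/
theorem isRegularSimplex_of_sum_eq_zero {s : ℕ} (hs : 0 < s) (φ : Fin (s + 1) → H) {d : ℝ}
    (hd : 0 < d) (hnorm : ∀ j, ‖φ j‖ ^ 2 = d) (hsum : ∑ j, φ j = 0)
    (hw : ∀ i j, i ≠ j → (s : ℝ) ^ 2 * ‖inner ℂ (φ i) (φ j)‖ ^ 2 = d ^ 2) :
    IsRegularSimplex s φ := by
  have hs' : (0 : ℝ) < s := by exact_mod_cast hs
  have hsC : (s : ℂ) ≠ 0 := by exact_mod_cast hs.ne'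
  have hself : ∀ i, inner ℂ (φ i) (φ i) = (d : ℂ) := fun i => by
    rw [inner_self_eq_norm_sq_to_K, ← hnorm i]
    norm_cast
  have habs : ∀ i j, i ≠ j → ‖inner ℂ (φ i) (φ j)‖ = d / s := fun i j hij => by
    rw [eq_div_iff hs'.ne', ← sq_eq_sq₀ (by positivity) hd.le, ← hw i j hij]
    ring
  -- Pairing `φ i` with the zero sum shows that its inner products with the other `s` vectors add up
  -- to `-d`, the extreme value for moduli `d / s`.
  have hinner : ∀ i j, i ≠ j → inner ℂ (φ i) (φ j) = -((d / s : ℝ) : ℂ) := fun i j hij => by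
    refine eq_neg_of_sum_eq_neg (Finset.univ.erase i) (fun j => inner ℂ (φ i) (φ j))
      (fun k hk => habs i k (Finset.ne_of_mem_erase hk).symm) ?_ j
      (Finset.mem_erase.2 ⟨hij.symm, Finset.mem_univ _⟩)
    have h := Finset.add_sum_erase Finset.univ (fun j => inner ℂ (φ i) (φ j)) (Finset.mem_univ i)
    rw [← inner_sum Finset.univ φ, hsum, inner_zero_right, hself] at h
    rw [eq_neg_of_add_eq_zero_right h, Finset.card_erase_of_mem (Finset.mem_univ _)]
    simp only [Finset.card_univ, Fintype.card_fin, Nat.add_sub_cancel]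
    push_cast
    field_simp
  -- The Gram matrix is (d + d/s) I - (d/s) J with J the all-ones matrix; the J part disappears
  -- against the zero sum.
  have hgram : ∀ i j, inner ℂ (φ i) (φ j) =
      (if i = j then ((d + d / s : ℝ) : ℂ) else 0) - ((d / s : ℝ) : ℂ) := fun i j => by
    split_ifs with h
    · rw [h, hself]
      push_cast
      ring
    · rw [hinner i j h, zero_sub]
  have hpos : (0 : ℝ) < d + d / s := by positivity
  have hframe : ∀ k, ∑ j, (inner ℂ (φ j) (φ k) : ℂ) • φ j = ((d + d / s : ℝ) : ℂ) • φ k := by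
    intro k
    simp only [hgram, sub_smul, ite_smul, zero_smul, Finset.sum_sub_distrib, ← Finset.smul_sum,
      hsum, smul_zero, sub_zero]
    simp
  refine ⟨hs, ⟨⟨⟨d, hd, hnorm⟩, (d / s) ^ 2, fun i j hij => by rw [habs i j hij]⟩,
    fun j => Submodule.subset_span ⟨j, rfl⟩, d + d / s, hpos, fun y hy => ?_⟩, ?_⟩
  · induction hy using Submodule.span_induction with
    | mem x hx => obtain ⟨k, rfl⟩ := hx; exact hframe k
    | zero => simp
    | add x y _ _ hx hy => simp only [inner_add_right, add_smul, Finset.sum_add_distrib, hx, hy,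
        smul_add]
    | smul c x _ hx =>
      simp only [inner_smul_right, mul_smul, ← Finset.smul_sum, hx]
      rw [smul_comm]
  -- The only linear relations are the multiples of the zero sum, so the span has dimension (s + 1)
  -- - 1. Pairing a relation `c` with `φ i` expresses `c i` through the sum of all coefficients,
  -- independently of `i`.
  · have hker : LinearMap.ker (Fintype.linearCombination ℂ φ) =
        Submodule.span ℂ {(fun _ => 1 : Fin (s + 1) → ℂ)} := by
      refine le_antisymm (fun c hc => ?_) ?_
      · rw [LinearMap.mem_ker, Fintype.linearCombination_apply] at hc
        have h : ∀ i, ((d + d / s : ℝ) : ℂ) * c i = ((d / s : ℝ) : ℂ) * ∑ j, c j := fun i => by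
          have h1 : inner ℂ (φ i) (∑ j, c j • φ j) = 0 := by rw [hc, inner_zero_right]
          rw [inner_sum] at h1
          simp only [inner_smul_right, hgram, mul_sub, mul_ite, mul_zero,
            Finset.sum_sub_distrib, Finset.sum_ite_eq, Finset.mem_univ, if_true,
            ← Finset.sum_mul] at h1
          linear_combination h1
        have hne : ((d + d / s : ℝ) : ℂ) ≠ 0 := by exact_mod_cast hpos.ne'
        refine Submodule.mem_span_singleton.2 ⟨c 0, funext fun i => ?_⟩
        simp only [Pi.smul_apply, smul_eq_mul, mul_one]
        exact mul_left_cancel₀ hne ((h 0).trans (h i).symm)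
      · rw [Submodule.span_singleton_le_iff_mem, LinearMap.mem_ker,
          Fintype.linearCombination_apply]
        simpa using hsum
    have h := LinearMap.finrank_range_add_finrank_ker (Fintype.linearCombination ℂ φ)
    rw [hker, finrank_span_singleton (fun h => one_ne_zero (congrFun h 0)),
      Fintype.range_linearCombination, Module.finrank_fin_fun] at h
    omega

end Simplices

/-! ### Character sums over difference sets and the general criterion. -/

section DifferenceSetCharacters

variable {G : Type*} [AddCommGroup G]

/-- Counting representations of `g` as differences by their second components. -/
lemma ncard_differences_eq (D : Set G) (g : G) :
    {p : G × G | p.1 ∈ D ∧ p.2 ∈ D ∧ g = p.1 - p.2}.ncard = {y | y ∈ D ∧ y + g ∈ D}.ncard := by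
  symm
  refine Set.ncard_congr (fun y _ => (y + g, y)) (fun y hy => ⟨hy.2, hy.1, by simp⟩)
    (fun a b _ _ h => (Prod.ext_iff.1 h).2) ?_
  rintro ⟨x, y⟩ ⟨hx, hy, hg⟩
  simp only at hg
  exact ⟨y, ⟨hy, by simpa [hg] using hx⟩, by simp [hg]⟩

/-- A pair is determined by its second entry and the difference. The overlap of `D` with a translate
is the form in which every family below is counted. -/
lemma isDifferenceSet_iff {D : Set G} :
    IsDifferenceSet D ↔ ∃ l : ℕ, ∀ g : G, g ≠ 0 → {y | y ∈ D ∧ y + g ∈ D}.ncard = l := by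
  simp only [IsDifferenceSet, ncard_differences_eq]

/-- The complement of a difference set is a difference set. -/
theorem IsDifferenceSet.compl [Finite G] {D : Set G} (hD : IsDifferenceSet D) :
    IsDifferenceSet Dᶜ := by
  obtain ⟨l, hl⟩ := isDifferenceSet_iff.1 hD
  -- Inclusion-exclusion for `D` and its translate; with `l` added first, the subtraction does not
  -- truncate when `g ≠ 0`.
  refine isDifferenceSet_iff.2 ⟨Nat.card G + l - 2 * D.ncard, fun g hg => ?_⟩
  set E : Set G := (fun y => y + g) ⁻¹' D
  have hE : E.ncard = D.ncard :=
    Set.ncard_preimage_of_injective_subset_range (add_left_injective g)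
      (fun x _ => ⟨x - g, by simp⟩)
  have h1 := Set.ncard_union_add_ncard_inter D E
  have h2 := Set.ncard_add_ncard_compl (D ∪ E)
  have h3 : {y | y ∈ Dᶜ ∧ y + g ∈ Dᶜ} = (D ∪ E)ᶜ := by
    ext y
    simp [E]
  have h4 : (D ∩ E).ncard = l := hl g hg
  rw [h3]
  omega

open Classical in
/-- The squared modulus of a character sum over a difference set, in expanded form. -/
lemma sum_mul_conj_sum_eq [Fintype G] (D : Finset G) (ψ : AddChar G ℂ) {l : ℕ}
    (hl : ∀ g : G, g ≠ 0 → {p : G × G | p.1 ∈ D ∧ p.2 ∈ D ∧ g = p.1 - p.2}.ncard = l) :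
    (∑ x ∈ D, ψ x) * (starRingEnd ℂ) (∑ x ∈ D, ψ x) = l * ∑ g, ψ g + (D.card - l) := by
  have h1 : (∑ x ∈ D, ψ x) * (starRingEnd ℂ) (∑ x ∈ D, ψ x) =
      ∑ p ∈ D ×ˢ D, ψ (p.1 - p.2) := by
    rw [map_sum, Finset.sum_mul_sum, Finset.sum_product]
    refine Finset.sum_congr rfl fun x _ => Finset.sum_congr rfl fun y _ => ?_
    rw [sub_eq_add_neg, AddChar.map_add_eq_mul, AddChar.map_neg_eq_conj]
  -- Pairs are grouped by difference: `l` pairs for each `g ≠ 0` and `D.card` for `g = 0`, that is,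
  -- `l` everywhere plus a correction at zero.
  have h2 : ∀ g : G, ∑ p ∈ D ×ˢ D with p.1 - p.2 = g, ψ (p.1 - p.2) =
      l * ψ g + if g = 0 then (D.card - l : ℂ) else 0 := fun g => by
    rw [Finset.sum_congr rfl (g := fun _ => ψ g) (fun p hp => by rw [(Finset.mem_filter.1 hp).2]),
      Finset.sum_const, nsmul_eq_mul]
    split_ifs with hg
    · have : {p ∈ D ×ˢ D | p.1 - p.2 = g} = D.diag := by
        ext p
        simp only [hg, sub_eq_zero, Finset.mem_filter, Finset.mem_product, Finset.mem_diag]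
        grind
      rw [this, Finset.diag_card, hg, AddChar.map_zero_eq_one]
      ring
    · rw [← hl g hg, ← Set.ncard_coe_finset, add_zero]
      congr 3
      ext p
      simp [and_assoc, eq_comm]
  rw [h1, ← Finset.sum_fiberwise (s := D ×ˢ D) (fun p : G × G => p.1 - p.2),
    Finset.sum_congr rfl fun g _ => h2 g, Finset.sum_add_distrib, ← Finset.mul_sum]
  simp

/-- The defining parameter identity `l (n - 1) = d (d - 1)` of a difference set. -/
lemma card_mul_card_sub_one [Fintype G] (D : Finset G) {l : ℕ}
    (hl : ∀ g : G, g ≠ 0 → {p : G × G | p.1 ∈ D ∧ p.2 ∈ D ∧ g = p.1 - p.2}.ncard = l) :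
    (l : ℝ) * (Fintype.card G - 1) = D.card * (D.card - 1) := by
  have h := sum_mul_conj_sum_eq D 0 hl
  simp only [AddChar.zero_apply, Finset.sum_const, Finset.card_univ, nsmul_eq_mul, mul_one,
    map_natCast] at h
  have h' : (D.card : ℝ) * D.card = l * Fintype.card G + (D.card - l) := by exact_mod_cast h
  linarith

/-- Nontrivial character sums over a difference set. -/
lemma norm_sum_sq_of_ne_zero [Fintype G] (D : Finset G) {ψ : AddChar G ℂ} (hψ : ψ ≠ 0) {l : ℕ}
    (hl : ∀ g : G, g ≠ 0 → {p : G × G | p.1 ∈ D ∧ p.2 ∈ D ∧ g = p.1 - p.2}.ncard = l) :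
    ‖∑ x ∈ D, ψ x‖ ^ 2 = D.card - l := by
  have h := sum_mul_conj_sum_eq D ψ hl
  rw [AddChar.sum_eq_zero_iff_ne_zero.2 hψ, mul_zero, zero_add, Complex.mul_conj,
    Complex.normSq_eq_norm_sq] at h
  exact_mod_cast h

/-- Characters of `G` can be arranged into cosets of the group of characters that are trivial on
a subgroup `H`. -/
lemma exists_coset_enumeration [Fintype G] (H : AddSubgroup G) {v s : ℕ} (hv : Nat.card H = v)
    (hn : Nat.card G = v * (s + 1)) :
    ∃ (c : Fin v → AddChar G ℂ) (p : Fin (s + 1) → AddChar G ℂ),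
      Function.Bijective (fun ij : Fin v × Fin (s + 1) => c ij.1 * p ij.2) ∧
      ∀ x ∉ H, ∑ j, p j x = 0 := by
  classical
  have hv0 : 0 < v := hv ▸ Nat.card_pos
  let π : G →+ G ⧸ H := QuotientAddGroup.mk' H
  let r : AddChar (G ⧸ H) ℂ →* AddChar G ℂ :=
    { toFun := fun ψ => ψ.compAddMonoidHom π
      map_one' := rfl
      map_mul' := fun _ _ => rfl }
  have hr : Function.Injective r :=
    AddChar.compAddMonoidHom_injective_left π (QuotientAddGroup.mk'_surjective H)
  -- `P` is the annihilator of `H`: the characters of the quotient by `H`, pulled back to `G`.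
  let P : Subgroup (AddChar G ℂ) := r.range
  let e : AddChar (G ⧸ H) ℂ ≃ P := Equiv.ofInjective r hr
  have hcardQ : Nat.card (G ⧸ H) = s + 1 := by
    have := AddSubgroup.card_eq_card_quotient_mul_card_addSubgroup H
    rw [hn, hv, mul_comm] at this
    exact (Nat.eq_of_mul_eq_mul_right hv0 this).symm
  have hcardC : Nat.card (AddChar (G ⧸ H) ℂ) = s + 1 := by
    have := Fintype.ofFinite (G ⧸ H)
    rw [Nat.card_eq_fintype_card, AddChar.card_eq, ← Nat.card_eq_fintype_card, hcardQ]
  have hcardP : Nat.card P = s + 1 := by rw [← Nat.card_congr e, hcardC]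
  have hcardG : Nat.card (AddChar G ℂ) = v * (s + 1) := by
    rw [Nat.card_eq_fintype_card, AddChar.card_eq, ← Nat.card_eq_fintype_card, hn]
  have hcardP' : Nat.card (AddChar G ℂ ⧸ P) = v := by
    have := Subgroup.card_eq_card_quotient_mul_card_subgroup P
    rw [hcardG, hcardP] at this
    exact (Nat.eq_of_mul_eq_mul_right s.succ_pos this).symm
  let eP : Fin (s + 1) ≃ AddChar (G ⧸ H) ℂ := (Finite.equivFinOfCardEq hcardC).symm
  let eQ : Fin v ≃ AddChar G ℂ ⧸ P := (Finite.equivFinOfCardEq hcardP').symm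
  refine ⟨fun i => (eQ i).out, fun j => r (eP j), ?_, fun x hx => ?_⟩
  · refine (Fintype.bijective_iff_injective_and_card _).2 ⟨?_, ?_⟩
    · rintro ⟨i, j⟩ ⟨i', j'⟩ h
      simp only at h
      have hmk := congrArg (QuotientGroup.mk (s := P)) h
      have hP : ∀ j, r (eP j) ∈ P := fun j => ⟨_, rfl⟩
      rw [QuotientGroup.mk_mul_of_mem _ (hP j), QuotientGroup.mk_mul_of_mem _ (hP j'),
        QuotientGroup.out_eq', QuotientGroup.out_eq'] at hmk
      obtain rfl := eQ.injective hmk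
      rw [eP.injective (hr (mul_left_cancel h))]
    · rw [← Nat.card_eq_fintype_card, ← Nat.card_eq_fintype_card, hcardG]
      simp
  -- Off `H` the class of `x` is nonzero, so the sum of all characters of the quotient vanishes
  -- there.
  · have hx' : (π x : G ⧸ H) ≠ 0 := fun h => hx ((QuotientAddGroup.eq_zero_iff x).1 h)
    rw [← AddChar.sum_apply_eq_zero_iff_ne_zero.2 hx']
    exact Fintype.sum_equiv eP _ _ fun j => rfl

/-- A difference set that is disjoint from a subgroup of suitable order yields a harmonic ETF
that is a disjoint union of regular simplices. -/
theorem yieldsHarmonicETFOfSimplices_of_disjoint [Finite G] {D : Set G} (hD : IsDifferenceSet D)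
    (H : AddSubgroup G) (hDH : ∀ x ∈ D, x ∉ H) {d n v s : ℕ} (hn : Nat.card G = n)
    (hd : D.ncard = d) (hv : Nat.card H = v) (hd0 : 0 < d) (hs : 0 < s) (hvs : n = v * (s + 1))
    (hpar : (s : ℝ) ^ 2 * (n - d) = d * (n - 1)) :
    YieldsHarmonicETFOfSimplices D d n v s := by
  classical
  have := Fintype.ofFinite G
  have hnF : Fintype.card G = n := by rw [← hn, Nat.card_eq_fintype_card]
  obtain ⟨l, hl⟩ := hD
  obtain ⟨c, p, hbij, hker⟩ := exists_coset_enumeration H hv (hn.trans hvs)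
  let γ : Fin n ≃ AddChar G ℂ := Fintype.equivOfCardEq (by simp [hnF])
  let g : Fin d ≃ D := (Finite.equivFinOfCardEq hd).symm
  let F : AddChar G ℂ → EuclideanSpace ℂ (Fin d) := fun χ => WithLp.toLp 2 fun i => χ (g i)
  let E : Finset G := D.toFinset
  have hEc : E.card = d := by rw [← hd, Set.ncard_eq_toFinset_card']
  have hl' : ∀ g : G, g ≠ 0 →
      {p : G × G | p.1 ∈ E ∧ p.2 ∈ E ∧ g = p.1 - p.2}.ncard = l := by
    simpa [E] using hl
  have hsumD : ∀ f : G → ℂ, ∑ i, f (g i) = ∑ x ∈ E, f x := fun f => by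
    rw [g.sum_comp (fun x : D => f x), ← Finset.sum_coe_sort E]
    exact Fintype.sum_equiv (Equiv.subtypeEquivRight fun x => by simp [E]) _ _ fun _ => rfl
  have hinner : ∀ χ χ', inner ℂ (F χ) (F χ') = ∑ x ∈ E, (χ' - χ) x := fun χ χ' => by
    rw [← hsumD, PiLp.inner_apply]
    refine Finset.sum_congr rfl fun i _ => ?_
    rw [AddChar.sub_apply, AddChar.map_neg_eq_conj]
    rfl
  have hnorm : ∀ χ, ‖F χ‖ ^ 2 = (d : ℝ) := fun χ => by
    have h := hinner χ χ
    rw [inner_self_eq_norm_sq_to_K, sub_self] at h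
    simp only [AddChar.zero_apply, Finset.sum_const, nsmul_eq_mul, mul_one, hEc] at h
    refine Complex.ofReal_injective (Eq.trans ?_ h)
    norm_cast
  have hoff : ∀ χ χ', χ ≠ χ' → ‖inner ℂ (F χ) (F χ')‖ ^ 2 = (d - l : ℝ) := fun χ χ' h => by
    rw [hinner, norm_sum_sq_of_ne_zero E (sub_ne_zero.2 h.symm) hl', hEc]
  have hd0' : (0 : ℝ) < d := by exact_mod_cast hd0
  have hn0 : 0 < n := hn ▸ Nat.card_pos
  refine ⟨fun j => F (γ j), ⟨‹_›, ⟨l, hl⟩, ⟨γ, g, fun j i => rfl⟩,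
    ⟨⟨d, hd0', fun j => hnorm _⟩, d - l, fun j j' h => hoff _ _ (γ.injective.ne h)⟩,
    fun _ => Submodule.mem_top, n, by exact_mod_cast hn0, fun y _ => ?_⟩, ?_⟩
  -- Tightness, with frame constant `n`, is the orthogonality of evaluations at distinct points of
  -- `D`, summed over all characters.
  · rw [γ.sum_comp fun χ => inner ℂ (F χ) y • F χ]
    ext i
    have h : ∀ k, ∑ χ : AddChar G ℂ, (starRingEnd ℂ) (χ (g k)) * χ (g i) =
        if k = i then (n : ℂ) else 0 := fun k => by
      have h1 : ∀ χ : AddChar G ℂ,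
          (starRingEnd ℂ) (χ (g k)) * χ (g i) = χ ((g i : G) - g k) := fun χ => by
        rw [sub_eq_add_neg, AddChar.map_add_eq_mul, AddChar.map_neg_eq_conj, mul_comm]
      rw [Finset.sum_congr rfl fun χ _ => h1 χ, AddChar.sum_apply_eq_ite, hnF]
      refine if_congr ?_ rfl rfl
      rw [sub_eq_zero, Subtype.val_inj, g.injective.eq_iff, eq_comm]
    have h2 : ∀ χ, (inner ℂ (F χ) y • F χ) i =
        ∑ k, y k * ((starRingEnd ℂ) (χ (g k)) * χ (g i)) := fun χ => by
      rw [PiLp.smul_apply, PiLp.inner_apply, smul_eq_mul, Finset.sum_mul]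
      refine Finset.sum_congr rfl fun k _ => ?_
      rw [← mul_assoc]
      rfl
    rw [WithLp.ofLp_sum, Finset.sum_apply, Finset.sum_congr rfl fun χ _ => h2 χ, Finset.sum_comm]
    simp only [← Finset.mul_sum, h]
    simp [mul_comm]
  -- Eliminating `l` by `l (n - 1) = d (d - 1)` turns `hpar` into the statement that off-diagonal
  -- moduli are `d / s`; cancelling `n - 1` needs `n ≥ 2`.
  · have hdl : (s : ℝ) ^ 2 * (d - l) = (d : ℝ) ^ 2 := by
      have h := card_mul_card_sub_one E hl'
      rw [hEc, hnF] at h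
      have hn1 : (0 : ℝ) < n - 1 := by
        have : 1 * 2 ≤ v * (s + 1) := Nat.mul_le_mul (hv ▸ Nat.card_pos) (by omega)
        rw [← hvs] at this
        have : (2 : ℝ) ≤ n := by exact_mod_cast this
        linarith
      refine mul_right_cancel₀ hn1.ne' ?_
      linear_combination (d : ℝ) * hpar - (s : ℝ) ^ 2 * h
    refine ⟨(Equiv.ofBijective _ hbij).trans γ.symm, fun i => ?_⟩
    refine isRegularSimplex_of_sum_eq_zero hs _ hd0' (fun j => hnorm _) ?_ fun j j' h => ?_
    · ext k
      rw [WithLp.ofLp_sum, Finset.sum_apply]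
      simp only [Equiv.trans_apply, Equiv.apply_symm_apply, Equiv.ofBijective_apply, F,
        AddChar.mul_apply, ← Finset.mul_sum]
      rw [hker _ (hDH _ (g k).2), mul_zero]
      rfl
    · rw [hoff _ _ ?_, hdl]
      simp only [Equiv.trans_apply, Equiv.apply_symm_apply]
      exact fun h' => h (Prod.ext_iff.1 ((Equiv.ofBijective _ hbij).injective h')).2

end DifferenceSetCharacters

/-! ### Twin prime power difference sets. -/

section TwinPrimePowers

/-- The autocorrelation of the quadratic character of a finite field. -/
lemma sum_quadraticChar_mul_quadraticChar_add {K : Type*} [Field K] [Fintype K] [DecidableEq K]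
    (hK : ringChar K ≠ 2) (a : K) :
    ∑ x, quadraticChar K x * quadraticChar K (x + a) =
      if a = 0 then (Fintype.card K : ℤ) - 1 else -1 := by
  have hsplit : ∀ x, quadraticChar K x * quadraticChar K (x + a) =
      if x = 0 then 0 else quadraticChar K (1 + a * x⁻¹) := fun x => by
    split_ifs with hx
    · simp [hx]
    · have : x + a = x * (1 + a * x⁻¹) := by field_simp
      rw [this, map_mul, ← mul_assoc, ← sq, quadraticChar_sq_one hx, one_mul]
  simp_rw [hsplit]
  split_ifs with ha
  · subst ha
    simp only [zero_mul, add_zero, map_one, Finset.sum_ite, Finset.sum_const_zero, zero_add,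
      Finset.sum_const, nsmul_eq_mul, mul_one]
    rw [Finset.filter_ne' Finset.univ, Finset.card_erase_of_mem (Finset.mem_univ _),
      Finset.card_univ, Nat.cast_sub Fintype.card_pos, Nat.cast_one]
  -- With the convention `0⁻¹ = 0` this map is a bijection of all of `K`. The spurious term at `x =
  -- 0` is the character at 1, which `h1` subtracts.
  · have hbij : Function.Bijective (fun x : K => 1 + a * x⁻¹) := by
      refine Finite.injective_iff_bijective.1 fun x y h => ?_
      simpa [ha] using h
    have h1 : ∀ x : K, (if x = 0 then 0 else quadraticChar K (1 + a * x⁻¹)) =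
        quadraticChar K (1 + a * x⁻¹) - if x = 0 then 1 else 0 := fun x => by
      split_ifs with hx <;> simp [hx]
    rw [Finset.sum_congr rfl fun x _ => h1 x, Finset.sum_sub_distrib,
      hbij.sum_comp (fun x => quadraticChar K x), quadraticChar_sum_zero hK]
    simp

variable {K L : Type*} [Field K] [Field L] [Fintype K] [Fintype L] [DecidableEq K] [DecidableEq L]

variable (K L) in
/-- The function with values `1` on `twinPrimePowerSet K L` and `-1` off it. -/
def twinSign (z : K × L) : ℤ :=
  quadraticChar K z.1 * quadraticChar L z.2 + (if z.2 = 0 then 1 else 0) - (if z.1 = 0 then 1 else 0)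
    + (if z.1 = 0 then 1 else 0) * (if z.2 = 0 then 1 else 0)

-- Writing the sign function as a combination of products of a function of x and a function of y
-- lets its sums and correlations factor into sums over `K` and over `L`.
open Classical in
lemma twinSign_eq (z : K × L) :
    twinSign K L z = if z ∈ twinPrimePowerSet K L then 1 else -1 := by
  obtain ⟨x, y⟩ := z
  simp only [twinSign, twinPrimePowerSet, Set.mem_ofPred_eq]
  by_cases hy : y = 0
  · simp [hy]
  by_cases hx : x = 0
  · simp [hx, hy]
  by_cases hxs : IsSquare x <;> by_cases hys : IsSquare y <;>
    simp [hx, hy, hxs, hys, quadraticChar_apply, quadraticCharFun]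

/-- With q the order of `K`, the four product terms contribute 0, q, -(q + 2) and 1. -/
lemma sum_twinSign (hK : ringChar K ≠ 2) (hc : Fintype.card L = Fintype.card K + 2) :
    ∑ z, twinSign K L z = -1 := by
  have hexp : ∑ z, twinSign K L z = (∑ x, quadraticChar K x) * (∑ y, quadraticChar L y)
      + (∑ _x : K, 1) * (∑ y : L, if y = 0 then 1 else 0)
      - (∑ x : K, if x = 0 then 1 else 0) * (∑ _y : L, 1)
      + (∑ x : K, if x = 0 then 1 else 0) * (∑ y : L, if y = 0 then 1 else 0) := by
    simp only [Finset.sum_mul_sum, ← Finset.sum_add_distrib, ← Finset.sum_sub_distrib,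
      Fintype.sum_prod_type, twinSign, one_mul, mul_one]
  rw [hexp, quadraticChar_sum_zero hK]
  simp [hc]

/-- Odd orders that differ by 2 lie in different classes mod 4, so -1 is a square in exactly one of
the two fields. -/
lemma quadraticChar_neg_one_mul (hK : ringChar K ≠ 2) (hL : ringChar L ≠ 2)
    (hc : Fintype.card L = Fintype.card K + 2) :
    quadraticChar K (-1) * quadraticChar L (-1) = -1 := by
  rw [quadraticChar_neg_one hK, quadraticChar_neg_one hL, hc, ZMod.χ₄_nat_eq_if_mod_four,
    ZMod.χ₄_nat_eq_if_mod_four]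
  have := FiniteField.odd_card_of_char_ne_two hK
  split_ifs <;> omega

/-- The autocorrelation of `twinSign` away from zero is constant. -/
lemma sum_twinSign_mul_twinSign_add (hK : ringChar K ≠ 2) (hL : ringChar L ≠ 2)
    (hc : Fintype.card L = Fintype.card K + 2) {g : K × L} (hg : g ≠ 0) :
    ∑ z, twinSign K L z * twinSign K L (z + g) = -1 := by
  obtain ⟨a, b⟩ := g
  let δ : K → ℤ := fun x => if x = 0 then 1 else 0
  let ε : L → ℤ := fun y => if y = 0 then 1 else 0
  let χ : K → ℤ := fun x => quadraticChar K x
  let ψ : L → ℤ := fun y => quadraticChar L y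
  have hχ : ∑ x, χ x = 0 := quadraticChar_sum_zero hK
  have hψ : ∑ y, ψ y = 0 := quadraticChar_sum_zero hL
  have hχa : ∑ x, χ (x + a) = 0 := (Equiv.sum_comp (Equiv.addRight a) χ).trans hχ
  have hψb : ∑ y, ψ (y + b) = 0 := (Equiv.sum_comp (Equiv.addRight b) ψ).trans hψ
  have hδ : ∑ x, δ x = 1 := by simp [δ]
  have hε : ∑ y, ε y = 1 := by simp [ε]
  have hδa : ∑ x, δ (x + a) = 1 := (Equiv.sum_comp (Equiv.addRight a) δ).trans hδ
  have hεb : ∑ y, ε (y + b) = 1 := (Equiv.sum_comp (Equiv.addRight b) ε).trans hε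
  have hδχ : ∑ x, δ x * χ (x + a) = χ a := by simp [δ]
  have hεψ : ∑ y, ε y * ψ (y + b) = ψ b := by simp [ε]
  have hδδ : ∑ x, δ x * δ (x + a) = δ a := by
    simp only [δ, ite_mul, one_mul, zero_mul, Finset.sum_ite_eq', Finset.mem_univ, if_true, zero_add]
  have hεε : ∑ y, ε y * ε (y + b) = ε b := by
    simp only [ε, ite_mul, one_mul, zero_mul, Finset.sum_ite_eq', Finset.mem_univ, if_true, zero_add]
  have hχδ : ∑ x, χ x * δ (x + a) = χ (-1) * χ a := by
    simp only [δ, χ, add_eq_zero_iff_eq_neg, ← map_mul, neg_one_mul, mul_ite, mul_one, mul_zero,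
      Finset.sum_ite_eq', Finset.mem_univ, if_true]
  have hψε : ∑ y, ψ y * ε (y + b) = ψ (-1) * ψ b := by
    simp only [ε, ψ, add_eq_zero_iff_eq_neg, ← map_mul, neg_one_mul, mul_ite, mul_one, mul_zero,
      Finset.sum_ite_eq', Finset.mem_univ, if_true]
  have hχχ : ∑ x, χ x * χ (x + a) = δ a * (Fintype.card K : ℤ) - 1 := by
    rw [sum_quadraticChar_mul_quadraticChar_add hK]
    simp only [δ]
    split_ifs <;> ring
  have hψψ : ∑ y, ψ y * ψ (y + b) = ε b * (Fintype.card L : ℤ) - 1 := by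
    rw [sum_quadraticChar_mul_quadraticChar_add hL]
    simp only [ε]
    split_ifs <;> ring
  have hneg : χ (-1) * ψ (-1) = -1 := quadraticChar_neg_one_mul hK hL hc
  -- Four product terms in each factor give sixteen separated sums.
  have hexp : ∑ z, twinSign K L z * twinSign K L (z + (a, b)) =
      (∑ x, χ x * χ (x + a)) * (∑ y, ψ y * ψ (y + b))
      + (∑ x, χ x) * (∑ y, ψ y * ε (y + b))
      - (∑ x, χ x * δ (x + a)) * (∑ y, ψ y)
      + (∑ x, χ x * δ (x + a)) * (∑ y, ψ y * ε (y + b))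
      + (∑ x, χ (x + a)) * (∑ y, ε y * ψ (y + b))
      + (∑ _x : K, 1) * (∑ y, ε y * ε (y + b))
      - (∑ x, δ (x + a)) * (∑ y, ε y)
      + (∑ x, δ (x + a)) * (∑ y, ε y * ε (y + b))
      - (∑ x, δ x * χ (x + a)) * (∑ y, ψ (y + b))
      - (∑ x, δ x) * (∑ y, ε (y + b))
      + (∑ x, δ x * δ (x + a)) * (∑ _y : L, 1)
      - (∑ x, δ x * δ (x + a)) * (∑ y, ε (y + b))
      + (∑ x, δ x * χ (x + a)) * (∑ y, ε y * ψ (y + b))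
      + (∑ x, δ x) * (∑ y, ε y * ε (y + b))
      - (∑ x, δ x * δ (x + a)) * (∑ y, ε y)
      + (∑ x, δ x * δ (x + a)) * (∑ y, ε y * ε (y + b)) := by
    simp only [Finset.sum_mul_sum, ← Finset.sum_add_distrib, ← Finset.sum_sub_distrib,
      Fintype.sum_prod_type]
    refine Finset.sum_congr rfl fun x _ => Finset.sum_congr rfl fun y _ => ?_
    simp only [twinSign, Prod.fst_add, Prod.snd_add, δ, ε, χ, ψ]
    ring
  have hKc : (∑ _x : K, (1 : ℤ)) = Fintype.card K := by simp
  have hLc : (∑ _y : L, (1 : ℤ)) = Fintype.card K + 2 := by simp [hc]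
  rw [hexp, hχχ, hψψ, hχ, hψ, hχδ, hψε, hχa, hψb, hδχ, hεψ, hδδ, hεε, hδa, hεb, hδ, hε, hKc, hLc,
    hc]
  push_cast
  -- This sign makes the only two terms depending on the values `χ a` and `ψ b` cancel.
  have hcross : χ (-1) * χ a * (ψ (-1) * ψ b) = -(χ a * ψ b) := by
    linear_combination χ a * ψ b * hneg
  rw [hcross]
  by_cases ha : a = 0 <;> by_cases hb : b = 0
  · exact absurd (by rw [ha, hb]; rfl) hg
  all_goals
    simp only [δ, ε, ha, hb, if_true, if_false]
    ring

open Classical in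
lemma two_mul_ncard_twinPrimePowerSet (hK : ringChar K ≠ 2)
    (hc : Fintype.card L = Fintype.card K + 2) :
    2 * ((twinPrimePowerSet K L).ncard : ℤ) + 1 = Fintype.card K * (Fintype.card K + 2) := by
  have h1 : ∀ z : K × L, twinSign K L z = 2 * (if z ∈ twinPrimePowerSet K L then 1 else 0) - 1 :=
    fun z => by rw [twinSign_eq]; split_ifs <;> rfl
  have h2 := sum_twinSign hK hc
  rw [Finset.sum_congr rfl fun z _ => h1 z, Finset.sum_sub_distrib, ← Finset.mul_sum,
    Finset.sum_boole] at h2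
  simp only [Finset.sum_const, Finset.card_univ, Fintype.card_prod, hc, nsmul_eq_mul] at h2
  have h3 : (twinPrimePowerSet K L).ncard = Finset.card {z | z ∈ twinPrimePowerSet K L} := by
    rw [← Set.ncard_coe_finset]
    simp
  rw [h3]
  push_cast at h2 ⊢
  linarith

open Classical in
/-- Twin prime power difference sets are difference sets. -/
theorem isDifferenceSet_twinPrimePowerSet (hK : ringChar K ≠ 2) (hL : ringChar L ≠ 2)
    (hc : Fintype.card L = Fintype.card K + 2) :
    IsDifferenceSet (twinPrimePowerSet K L) := by
  set n := Fintype.card K * (Fintype.card K + 2)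
  refine isDifferenceSet_iff.2 ⟨(n - 3) / 4, fun g hg => ?_⟩
  set D := twinPrimePowerSet K L
  -- Twice the indicator of `D` is 1 + `twinSign`; multiplying this at `z` and `z + g` and summing
  -- gives n - 1 - 1 - 1.
  have h1 : ∀ z : K × L, (4 : ℤ) * (if z ∈ D ∧ z + g ∈ D then 1 else 0) =
      1 + twinSign K L z + twinSign K L (z + g) + twinSign K L z * twinSign K L (z + g) :=
    fun z => by
      rw [twinSign_eq, twinSign_eq]
      by_cases h : z ∈ D <;> by_cases h' : z + g ∈ D <;> simp [D, h, h']
  have h2 : ∑ z, twinSign K L (z + g) = -1 :=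
    (Equiv.sum_comp (Equiv.addRight g) (twinSign K L)).trans (sum_twinSign hK hc)
  have h3 : ∑ z : K × L, (1 : ℤ) = n := by
    simp [n, hc]
  have h4 : (4 : ℤ) * ∑ z : K × L, (if z ∈ D ∧ z + g ∈ D then 1 else 0) = n - 3 := by
    rw [Finset.mul_sum, Finset.sum_congr rfl fun z _ => h1 z]
    simp only [Finset.sum_add_distrib]
    rw [h2, h3, sum_twinSign hK hc, sum_twinSign_mul_twinSign_add hK hL hc hg]
    ring
  have h5 : {y | y ∈ D ∧ y + g ∈ D}.ncard = Finset.card {z : K × L | z ∈ D ∧ z + g ∈ D} := by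
    rw [← Set.ncard_coe_finset]
    simp
  rw [Finset.sum_boole, ← h5] at h4
  omega

/-- The complement of a twin prime power difference set yields a harmonic ETF that is a disjoint
union of regular simplices. -/
theorem yieldsHarmonicETFOfSimplices_twinPrimePowerSet_compl {K L : Type*} [Field K]
    [Field L] [Finite K] [Finite L] {q : ℕ}
    (hq : Nat.card K = q) (hq' : Nat.card L = q + 2) (hodd : Odd q) :
    YieldsHarmonicETFOfSimplices (twinPrimePowerSet K L)ᶜ
      ((q + 1) ^ 2 / 2) (q * (q + 2)) q (q + 1) := by
  classical
  have := Fintype.ofFinite K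
  have := Fintype.ofFinite L
  have hcK : Fintype.card K = q := by rw [← hq, Nat.card_eq_fintype_card]
  have hcL : Fintype.card L = q + 2 := by rw [← hq', Nat.card_eq_fintype_card]
  have hc : Fintype.card L = Fintype.card K + 2 := by rw [hcK, hcL]
  have hK : ringChar K ≠ 2 := fun h2 => by
    have := FiniteField.even_card_of_char_two h2
    obtain ⟨k, hk⟩ := hodd
    omega
  have hL : ringChar L ≠ 2 := fun h2 => by
    have := FiniteField.even_card_of_char_two h2
    obtain ⟨k, hk⟩ := hodd
    omega
  have hn : Nat.card (K × L) = q * (q + 2) := by rw [Nat.card_prod, hq, hq']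
  have h1 := two_mul_ncard_twinPrimePowerSet (L := L) hK hc
  rw [hcK] at h1
  have h2 := Set.ncard_add_ncard_compl (twinPrimePowerSet K L)
  rw [hn] at h2
  have hd : 2 * (twinPrimePowerSet K L)ᶜ.ncard = (q + 1) ^ 2 := by
    zify at h2 ⊢
    linarith
  have hq0 : 0 < q := hq ▸ Nat.card_pos
  -- The subgroup is K × 0, which lies in the twin prime power set and so misses its complement.
  refine yieldsHarmonicETFOfSimplices_of_disjoint (isDifferenceSet_twinPrimePowerSet hK hL hc).compl
    (AddMonoidHom.snd K L).ker (fun x hx hxk => hx (Or.inl hxk)) hn (by omega) ?_ ?_ (by omega)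
    rfl ?_
  · rw [← hq]
    refine Nat.card_congr ⟨fun z => z.1.1, fun x => ⟨(x, 0), rfl⟩, ?_, fun _ => rfl⟩
    rintro ⟨⟨x, y⟩, hy⟩
    exact Subtype.ext (Prod.ext rfl hy.symm)
  · rw [← hd, Nat.mul_div_cancel_left _ two_pos]
    have : 0 < (q + 1) ^ 2 := by positivity
    omega
  · rw [← hd, Nat.mul_div_cancel_left _ two_pos]
    have hd' : (2 : ℝ) * (twinPrimePowerSet K L)ᶜ.ncard = (q + 1) ^ 2 := by exact_mod_cast hd
    push_cast
    have : ((twinPrimePowerSet K L)ᶜ.ncard : ℝ) = (q + 1) ^ 2 / 2 := by linarith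
    rw [this]
    ring

end TwinPrimePowers

/-! ### Counting hyperplanes over a finite field. -/

section Hyperplanes

/-- Two distinct subspaces of codimension one intersect in a subspace of codimension two. -/
lemma finrank_inf_add_two_of_ne {F V : Type*} [Field F] [AddCommGroup V] [Module F V]
    [FiniteDimensional F V] {U W : Submodule F V} (hU : Module.finrank F U + 1 = Module.finrank F V)
    (hW : Module.finrank F W + 1 = Module.finrank F V) (hne : U ≠ W) :
    Module.finrank F ↥(U ⊓ W) + 2 = Module.finrank F V ∧ U ⊔ W = ⊤ := by
  have hlt : U < U ⊔ W := by
    refine lt_of_le_of_ne le_sup_left fun h => hne ?_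
    have hle : W ≤ U := by rw [h]; exact le_sup_right
    exact (Submodule.eq_of_le_of_finrank_eq hle (by omega)).symm
  have h1 := Submodule.finrank_lt_finrank_of_lt hlt
  have h2 := Submodule.finrank_sup_add_finrank_inf_eq U W
  have h3 := Submodule.finrank_le (U ⊔ W)
  exact ⟨by omega, Submodule.eq_top_of_finrank_eq (by omega)⟩

lemma natCard_ne_zero_eq {M : Type*} [Zero M] [Finite M] :
    Nat.card {x : M // x ≠ 0} = Nat.card M - 1 := by
  have h := Set.ncard_compl ({0} : Set M)
  rw [Set.ncard_singleton] at h
  exact h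

variable {F : Type*} [Field F] [Finite F] {e : ℕ}

/-- The number of hyperplanes that contain a given subspace. -/
lemma natCard_hyperplane_ge_mul (W : Submodule F (Fin (e + 1) → F)) :
    Nat.card {U : Hyperplane F e // W ≤ U.1} * (Nat.card F - 1) =
      Nat.card F ^ (e + 1 - Module.finrank F W) - 1 := by
  classical
  set V := Fin (e + 1) → F
  have hV : Module.finrank F V = e + 1 := by simp [V]
  have : Finite (Module.Dual F V) := Module.finite_of_finite F
  have hker : ∀ φ : Module.Dual F V, φ ≠ 0 → Module.finrank F (LinearMap.ker φ) = e :=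
    fun φ hφ => by
      have := Module.Dual.finrank_ker_add_one_of_ne_zero hφ
      rw [hV] at this
      omega
  -- Nonzero functionals vanishing on `W` are sent to their kernels. The fibre over `U` is the set
  -- of nonzero elements of a line, the annihilator of `U`.
  let f : {φ : W.dualAnnihilator // φ ≠ 0} → {U : Hyperplane F e // W ≤ U.1} := fun φ =>
    ⟨⟨LinearMap.ker φ.1.1, hker _ fun h => φ.2 (Subtype.ext h)⟩,
      fun w hw => (Submodule.mem_dualAnnihilator _).1 φ.1.2 w hw⟩
  have hfib : ∀ U, Nat.card {φ // f φ = U} = Nat.card F - 1 := fun U => by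
    have hU : Module.finrank F U.1.1.dualAnnihilator = 1 := by
      have := Subspace.finrank_add_finrank_dualAnnihilator_eq U.1.1
      rw [U.1.2, hV] at this
      omega
    have hcard : Nat.card {φ : U.1.1.dualAnnihilator // φ ≠ 0} = Nat.card F - 1 := by
      rw [natCard_ne_zero_eq, Module.natCard_eq_pow_finrank (K := F), hU, pow_one]
    rw [← hcard]
    refine Nat.card_congr ⟨fun φ => ⟨⟨φ.1.1.1, ?_⟩, ?_⟩, fun φ => ⟨⟨⟨φ.1.1, ?_⟩, ?_⟩, ?_⟩,
      fun _ => rfl, fun _ => rfl⟩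
    · have h : LinearMap.ker φ.1.1.1 = U.1.1 := congrArg (fun U => U.1.1) φ.2
      rw [Submodule.mem_dualAnnihilator, ← h]
      exact fun w hw => hw
    · exact fun h => φ.1.2 (Subtype.ext (congrArg (fun ψ => ψ.1) h))
    · exact Submodule.dualAnnihilator_anti U.2 φ.1.2
    · exact fun h => φ.2 (Subtype.ext (congrArg (fun ψ => ψ.1) h))
    · refine Subtype.ext (Subtype.ext (Submodule.eq_of_le_of_finrank_eq (fun w hw => ?_) ?_).symm)
      · exact (Submodule.mem_dualAnnihilator _).1 φ.1.2 w hw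
      · exact U.1.2.trans (hker _ fun h => φ.2 (Subtype.ext h)).symm
  have := Fintype.ofFinite {U : Hyperplane F e // W ≤ U.1}
  have h := Nat.card_congr (Equiv.sigmaFiberEquiv f)
  rw [Nat.card_sigma, Finset.sum_congr rfl fun U _ => hfib U, natCard_ne_zero_eq,
    Module.natCard_eq_pow_finrank (K := F) (V := W.dualAnnihilator), Finset.sum_const,
    smul_eq_mul, Finset.card_univ, ← Nat.card_eq_fintype_card] at h
  have h2 := Subspace.finrank_add_finrank_dualAnnihilator_eq W
  rw [hV] at h2
  rw [h]
  congr 2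
  omega

/-- The number of hyperplanes of `F^(e+1)`. -/
lemma natCard_hyperplane_mul :
    Nat.card (Hyperplane F e) * (Nat.card F - 1) = Nat.card F ^ (e + 1) - 1 := by
  have h := natCard_hyperplane_ge_mul (⊥ : Submodule F (Fin (e + 1) → F))
  rw [finrank_bot, Nat.card_congr (Equiv.subtypeUnivEquiv fun U : Hyperplane F e => bot_le)] at h
  exact h

/-- The number of hyperplanes of `F^(e+1)` through a nonzero vector. -/
lemma natCard_hyperplane_mem_mul {u : Fin (e + 1) → F} (hu : u ≠ 0) :
    Nat.card {U : Hyperplane F e // u ∈ U.1} * (Nat.card F - 1) = Nat.card F ^ e - 1 := by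
  have h := natCard_hyperplane_ge_mul (Submodule.span F {u})
  rw [finrank_span_singleton hu, Nat.add_sub_cancel] at h
  simpa only [Submodule.span_singleton_le_iff_mem] using h

lemma natCard_hyperplane_coe {F : Type*} [Field F] {e : ℕ} (U : Hyperplane F e) : Nat.card U.1 = Nat.card F ^ e := by
  rw [Module.natCard_eq_pow_finrank (K := F), U.2]

/-- A translate of a hyperplane meets every other hyperplane in `q^(e-1)` vectors. -/
lemma ncard_mem_and_add_mem {F : Type*} [Field F] {e : ℕ} (he : 1 ≤ e) {U W : Hyperplane F e}
    (hne : U ≠ W) (u : Fin (e + 1) → F) :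
    {w | w ∈ U.1 ∧ w + u ∈ W.1}.ncard = Nat.card F ^ (e - 1) := by
  have hV : Module.finrank F (Fin (e + 1) → F) = e + 1 := by simp
  obtain ⟨h1, h2⟩ := finrank_inf_add_two_of_ne (U := U.1) (W := W.1) (by rw [U.2, hV])
    (by rw [W.2, hV]) (fun h => hne (Subtype.ext h))
  obtain ⟨x, hx, y, hy, hxy⟩ := Submodule.mem_sup.1 (h2 ▸ Submodule.mem_top : u ∈ U.1 ⊔ W.1)
  have hinf : Nat.card ↥(U.1 ⊓ W.1) = Nat.card F ^ (e - 1) := by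
    rw [Module.natCard_eq_pow_finrank (K := F)]
    congr 1
    omega
  -- With `u = x + y`, `x ∈ U`, `y ∈ W`, translation by `x` carries the set onto `U ⊓ W`.
  rw [← hinf, ← Nat.card_coe_set_eq]
  refine Nat.card_congr ⟨fun w => ⟨w.1 + x, U.1.add_mem w.2.1 hx, ?_⟩,
    fun w => ⟨w.1 - x, U.1.sub_mem w.2.1 hx, ?_⟩, fun w => Subtype.ext (by simp),
    fun w => Subtype.ext (by simp)⟩
  · have h : w.1 + u - y = w.1 + x := by
      rw [sub_eq_iff_eq_add, add_assoc, hxy]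
    exact h ▸ W.1.sub_mem w.2.2 hy
  · have h : w.1 - x + u = w.1 + y := by
      rw [sub_add_eq_add_sub, sub_eq_iff_eq_add, add_assoc, add_comm y, hxy]
    exact h ▸ W.1.add_mem w.2.2 hy

end Hyperplanes

/-! ### McFarland difference sets. -/

section McFarland

variable {F : Type*} [Field F] [Finite F] {e : ℕ} {A : Type*}

/-- Counting a subset of `A × F^(e+1)` that projects into the range of `t` slice by slice. -/
lemma ncard_eq_sum_slices [Fintype (Hyperplane F e)] {t : Hyperplane F e → A}
    (ht : Function.Injective t) (E : Set (A × (Fin (e + 1) → F)))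
    (hE : ∀ z ∈ E, z.1 ∈ Set.range t) :
    E.ncard = ∑ U, {w | (t U, w) ∈ E}.ncard := by
  simp only [← Nat.card_coe_set_eq]
  rw [← Nat.card_sigma]
  symm
  refine Nat.card_congr (Equiv.ofBijective (fun z => ⟨(t z.1, z.2.1), z.2.2⟩) ⟨?_, ?_⟩)
  · rintro ⟨U, w, hw⟩ ⟨U', w', hw'⟩ h
    simp only [Subtype.mk.injEq, Prod.mk.injEq] at h
    obtain ⟨h1, rfl⟩ := h
    obtain rfl := ht h1
    rfl
  · rintro ⟨⟨a, w⟩, hz⟩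
    obtain ⟨U, rfl⟩ := hE _ hz
    exact ⟨⟨U, w, hz⟩, rfl⟩

lemma mem_mcFarlandSet_iff {F : Type*} [Field F] {e : ℕ} {A : Type*} {t : Hyperplane F e → A} (ht : Function.Injective t)
    (U : Hyperplane F e) (w : Fin (e + 1) → F) : (t U, w) ∈ mcFarlandSet t ↔ w ∈ U.1 := by
  refine ⟨?_, fun h => ⟨U, rfl, h⟩⟩
  rintro ⟨U', h1, h2⟩
  rwa [ht h1]

lemma ncard_mcFarlandSet {t : Hyperplane F e → A} (ht : Function.Injective t) :
    (mcFarlandSet t).ncard = Nat.card (Hyperplane F e) * Nat.card F ^ e := by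
  have := Fintype.ofFinite (Hyperplane F e)
  rw [ncard_eq_sum_slices ht _ fun z hz => by
    obtain ⟨U, hU, _⟩ := hz
    exact ⟨U, hU.symm⟩]
  simp only [mem_mcFarlandSet_iff ht]
  have hU : ∀ U : Hyperplane F e, {w | w ∈ U.1}.ncard = Nat.card F ^ e := natCard_hyperplane_coe
  rw [Finset.sum_congr rfl fun U _ => hU U, Finset.sum_const, smul_eq_mul,
    Finset.card_univ, ← Nat.card_eq_fintype_card]

open Classical in
/-- McFarland difference sets are difference sets. -/
theorem isDifferenceSet_mcFarlandSet [AddCommGroup A] (he : 1 ≤ e) {t : Hyperplane F e → A}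
    (ht : Function.Injective t) (hrange : Set.range t = {0}ᶜ) :
    IsDifferenceSet (mcFarlandSet t) := by
  have := Fintype.ofFinite (Hyperplane F e)
  set q := Nat.card F
  have hq : 1 < q := Finite.one_lt_card
  refine isDifferenceSet_iff.2 ⟨q ^ (e - 1) * (Nat.card (Hyperplane F e) - 1), ?_⟩
  rintro ⟨a, u⟩ hg
  rw [ncard_eq_sum_slices ht _ fun z hz => by
    obtain ⟨U, hU, _⟩ := hz.1
    exact ⟨U, hU.symm⟩]
  by_cases ha : a = 0
  -- For `a = 0` a slice is compared with its own translate: it contributes `q ^ e` if `u ∈ U` and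
  -- nothing otherwise.
  · have hu : u ≠ 0 := fun hu => hg (by rw [ha, hu]; rfl)
    have hslice : ∀ U : Hyperplane F e,
        {w | (t U, w) ∈ {y | y ∈ mcFarlandSet t ∧ y + (a, u) ∈ mcFarlandSet t}}.ncard =
          if u ∈ U.1 then q ^ e else 0 := fun U => by
      have h1 : {w | (t U, w) ∈ {y | y ∈ mcFarlandSet t ∧ y + (a, u) ∈ mcFarlandSet t}} =
          {w | w ∈ U.1 ∧ w + u ∈ U.1} := by
        ext w
        simp only [Set.mem_ofPred_eq, Prod.mk_add_mk, ha, add_zero, mem_mcFarlandSet_iff ht]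
      rw [h1]
      split_ifs with h
      · rw [← natCard_hyperplane_coe U]
        congr 1
        ext w
        simpa using fun hw => U.1.add_mem hw h
      · rw [Set.ncard_eq_zero]
        ext w
        simp only [Set.mem_ofPred_eq, Set.mem_empty_iff_false, iff_false, not_and]
        exact fun hw hwu => h ((U.1.add_mem_iff_right hw).1 hwu)
    rw [Finset.sum_congr rfl fun U _ => hslice U, ← Finset.sum_filter, Finset.sum_const,
      smul_eq_mul, ← Fintype.card_subtype, ← Nat.card_eq_fintype_card]
    have h1 : _ * (q - 1) = q ^ e - 1 := natCard_hyperplane_mem_mul hu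
    have h2 : Nat.card (Hyperplane F e) * (q - 1) = q ^ (e + 1) - 1 := natCard_hyperplane_mul
    have hq1 : 0 < q - 1 := by omega
    refine Nat.eq_of_mul_eq_mul_right hq1 ?_
    have h3 : (Nat.card (Hyperplane F e) - 1) * (q - 1) = q * (q ^ e - 1) := by
      rw [Nat.sub_mul, h2, one_mul, Nat.mul_sub q, ← pow_succ', mul_one]
      omega
    rw [mul_right_comm, h1, mul_assoc, h3, ← mul_assoc, ← pow_succ, Nat.sub_add_cancel he,
      mul_comm]
  -- For `a ≠ 0` exactly one hyperplane `V` is moved to the omitted value 0; every other one is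
  -- compared with a different hyperplane.
  · obtain ⟨V, hV⟩ : ∃ V, t V = -a := by
      have : -a ∈ Set.range t := by simpa [hrange] using ha
      exact this
    have hslice : ∀ U : Hyperplane F e,
        {w | (t U, w) ∈ {y | y ∈ mcFarlandSet t ∧ y + (a, u) ∈ mcFarlandSet t}}.ncard =
          if U = V then 0 else q ^ (e - 1) := fun U => by
      split_ifs with h
      · rw [Set.ncard_eq_zero]
        ext w
        simp only [Set.mem_ofPred_eq, Set.mem_empty_iff_false, iff_false, not_and, Prod.mk_add_mk,
          h, hV, neg_add_cancel]
        rintro - ⟨U', h', -⟩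
        have : (0 : A) ∈ Set.range t := ⟨U', h'.symm⟩
        simp [hrange] at this
      · obtain ⟨W, hW⟩ : ∃ W, t W = t U + a := by
          have : t U + a ∈ Set.range t := by
            rw [hrange, Set.mem_compl_singleton_iff, ne_eq, add_eq_zero_iff_eq_neg, ← hV]
            exact fun h' => h (ht h')
          exact this
        have hne : U ≠ W := by
          rintro rfl
          exact ha (left_eq_add.1 hW)
        rw [← ncard_mem_and_add_mem he hne u]
        congr 1
        ext w
        simp only [Set.mem_ofPred_eq, Prod.mk_add_mk, ← hW, mem_mcFarlandSet_iff ht]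
    rw [Finset.sum_congr rfl fun U _ => hslice U, Finset.sum_ite, Finset.sum_const_zero, zero_add,
      Finset.sum_const, smul_eq_mul, Finset.filter_ne' Finset.univ,
      Finset.card_erase_of_mem (Finset.mem_univ _), Finset.card_univ, ← Nat.card_eq_fintype_card,
      mul_comm]

/-- McFarland difference sets yield harmonic ETFs that are disjoint unions of regular simplices. -/
theorem exists_yieldsHarmonicETFOfSimplices_mcFarlandSet (F : Type*) [Field F] [Finite F] {q e : ℕ}
    (hF : Nat.card F = q) (he : 1 ≤ e) :
    ∃ (A : Type) (_ : AddCommGroup A) (t : Hyperplane F e → A),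
      Nat.card A = (q ^ (e + 1) - 1) / (q - 1) + 1 ∧ Function.Injective t ∧
      YieldsHarmonicETFOfSimplices (mcFarlandSet t)
        (q ^ e * ((q ^ (e + 1) - 1) / (q - 1)))
        (q ^ (e + 1) * (1 + (q ^ (e + 1) - 1) / (q - 1)))
        (q ^ (e + 1))
        ((q ^ (e + 1) - 1) / (q - 1)) := by
  have hq : 1 < q := hF ▸ Finite.one_lt_card
  have hq1 : 0 < q - 1 := by omega
  have hr := natCard_hyperplane_mul (F := F) (e := e)
  rw [hF] at hr
  rw [← hr, Nat.mul_div_cancel _ hq1]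
  set r := Nat.card (Hyperplane F e)
  have hr0 : 0 < r := by
    refine Nat.pos_of_ne_zero fun h => ?_
    have : 1 < q ^ (e + 1) := Nat.one_lt_pow e.succ_ne_zero hq
    rw [h, zero_mul] at hr
    omega
  have hA : Nat.card (ZMod (r + 1)) = r + 1 := Nat.card_zmod _
  -- Labelling the hyperplanes by all nonzero residues serves twice: the difference set property
  -- needs exactly 0 to be omitted, and this also makes the set miss the subgroup 0 × F^(e+1).
  let τ : Hyperplane F e ≃ {a : ZMod (r + 1) // a ≠ 0} :=
    (Finite.equivFin _).trans (Finite.equivFinOfCardEq (by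
      rw [natCard_ne_zero_eq, hA, Nat.add_sub_cancel])).symm
  let t : Hyperplane F e → ZMod (r + 1) := fun U => τ U
  have ht : Function.Injective t := Subtype.val_injective.comp τ.injective
  have hrange : Set.range t = {0}ᶜ := by
    ext a
    exact ⟨fun ⟨U, hU⟩ => hU ▸ (τ U).2, fun ha => ⟨τ.symm ⟨a, ha⟩, by simp [t]⟩⟩
  refine ⟨ZMod (r + 1), inferInstance, t, hA, ht, ?_⟩
  refine yieldsHarmonicETFOfSimplices_of_disjoint (isDifferenceSet_mcFarlandSet he ht hrange)
    (AddMonoidHom.fst (ZMod (r + 1)) (Fin (e + 1) → F)).ker ?_ ?_ ?_ ?_ (by positivity) hr0 ?_ ?_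
  · rintro x ⟨U, hU, -⟩ hx
    exact (τ U).2 (hU.symm.trans hx)
  · rw [Nat.card_prod, hA, Module.natCard_eq_pow_finrank (K := F), Module.finrank_fin_fun, hF]
    ring
  · rw [ncard_mcFarlandSet ht, hF, mul_comm]
  · have h : Nat.card (Fin (e + 1) → F) = q ^ (e + 1) := by
      rw [Module.natCard_eq_pow_finrank (K := F), Module.finrank_fin_fun, hF]
    rw [← h]
    refine Nat.card_congr ⟨fun z => z.1.2, fun x => ⟨(0, x), rfl⟩, ?_, fun _ => rfl⟩
    rintro ⟨⟨x, y⟩, hx⟩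
    exact Subtype.ext (Prod.ext hx.symm rfl)
  · ring
  · have hr' : (r : ℝ) * (q - 1) = q ^ (e + 1) - 1 := by
      have h : ((q - 1 : ℕ) : ℝ) = q - 1 := by push_cast [hq.le]; ring
      have h' : ((q ^ (e + 1) - 1 : ℕ) : ℝ) = q ^ (e + 1) - 1 := by
        rw [Nat.cast_sub (Nat.one_le_pow _ _ (by omega))]
        push_cast
        ring
      rw [← h, ← h', ← hr]
      push_cast
      ring
    push_cast
    linear_combination (r : ℝ) * q ^ e * (r + 1) * hr'

end McFarland

/-! ### Singer difference sets and intermediate fields. -/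

section Singer

variable {K L : Type*} [Field K] [Field L] [Algebra K L]

/-- A `K`-subspace is stable under scaling by `Kˣ`, so membership does not depend on the
representative. -/
lemma ofMul_mem_singerSet_iff (T : Submodule K L) (u : Lˣ) :
    (Additive.ofMul (u : Lˣ ⧸ (Units.map (algebraMap K L : K →* L)).range) : SingerGroup K L) ∈
      singerSet K T ↔ (u : L) ∈ T := by
  refine ⟨?_, fun h => ⟨u, h, rfl⟩⟩
  rintro ⟨w, hw, h⟩
  obtain ⟨c, hc⟩ := QuotientGroup.eq.1 (Additive.ofMul.injective h)
  have h1 : (w : L) = (u : L) * algebraMap K L c := by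
    have h2 : w = u * Units.map (algebraMap K L : K →* L) c := by rw [hc, mul_inv_cancel_left]
    rw [h2]
    rfl
  have h3 : (u : L) = ((c⁻¹ : Kˣ) : K) • (w : L) := by
    rw [h1, Algebra.smul_def, mul_left_comm, ← map_mul, Units.inv_mul, map_one, mul_one]
  rw [h3]
  exact T.smul_mem _ hw

/-- Number of points of a projective subspace. -/
lemma ncard_singerSet_mul [Finite K] [Finite L] (T : Submodule K L) :
    (singerSet K T).ncard * (Nat.card K - 1) = Nat.card K ^ Module.finrank K T - 1 := by
  set P : Subgroup Lˣ := (Units.map (algebraMap K L : K →* L)).range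
  have hP : Nat.card P = Nat.card K - 1 := by
    rw [← Nat.card_units]
    exact (Nat.card_congr (Equiv.ofInjective _
      (Units.map_injective (algebraMap K L).injective))).symm
  -- The preimage of `S` in `Lˣ` is `T` without 0, and the quotient map has fibres of size `Nat.card
  -- K - 1`.
  let S : Set (Lˣ ⧸ P) := singerSet K T
  have h1 := Nat.card_congr (QuotientGroup.preimageMkEquivSubgroupProdSet P S)
  rw [Nat.card_prod, hP, Nat.card_coe_set_eq S] at h1
  have h2 : Nat.card ((QuotientGroup.mk : Lˣ → Lˣ ⧸ P) ⁻¹' S) = Nat.card {x : T // x ≠ 0} :=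
    Nat.card_congr ⟨fun u => ⟨⟨u.1, (ofMul_mem_singerSet_iff T u.1).1 u.2⟩,
        fun h => u.1.ne_zero (congrArg Subtype.val h)⟩,
      fun x => ⟨Units.mk0 x.1.1 fun h => x.2 (Subtype.ext h),
        (ofMul_mem_singerSet_iff T _).2 x.1.2⟩,
      fun u => Subtype.ext (Units.ext rfl), fun x => rfl⟩
  rw [h2, natCard_ne_zero_eq, Module.natCard_eq_pow_finrank (K := K)] at h1
  rw [h1, mul_comm]
  rfl

lemma natCard_singerGroup_mul [Finite K] [Finite L] :
    Nat.card (SingerGroup K L) * (Nat.card K - 1) = Nat.card K ^ Module.finrank K L - 1 := by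
  have h : singerSet K (⊤ : Submodule K L) = Set.univ := by
    refine Set.eq_univ_of_forall fun g => ?_
    obtain ⟨u, hu⟩ := QuotientGroup.mk_surjective g.toMul
    exact ⟨u, Submodule.mem_top, congrArg Additive.ofMul hu.symm⟩
  rw [← finrank_top K L, ← ncard_singerSet_mul, h, Set.ncard_univ]

/-- A hyperplane of `L` is only stable under multiplication by elements of `K`. -/
lemma ker_comp_mulLeft_ne {φ : Module.Dual K L} (hφ : φ ≠ 0) {c : L}
    (hc : ∀ k : K, algebraMap K L k ≠ c) :
    LinearMap.ker φ ≠ LinearMap.ker (φ ∘ₗ LinearMap.mulLeft K c) := by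
  intro h
  obtain ⟨x, hx⟩ : ∃ x, φ x = 1 := by
    obtain ⟨y, hy⟩ : ∃ y, φ y ≠ 0 := by
      by_contra! h0
      exact hφ (LinearMap.ext h0)
    exact ⟨(φ y)⁻¹ • y, by simp [hy]⟩
  -- If the kernels agreed, `y - φ y • x` would lie in both, so multiplication by `c` would act
  -- under `φ` as the scalar `φ (c * x)`. Then `φ` would kill every multiple of the nonzero element
  -- `c - φ (c * x)`, hence all of `L`.
  have h1 : ∀ y, φ (c * y) = φ y * φ (c * x) := fun y => by
    have h2 : y - φ y • x ∈ LinearMap.ker φ := by simp [hx]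
    rw [h, LinearMap.mem_ker, LinearMap.comp_apply, LinearMap.mulLeft_apply, mul_sub,
      mul_smul_comm, map_sub, map_smul, smul_eq_mul, sub_eq_zero] at h2
    exact h2
  have h3 : ∀ y, φ ((c - algebraMap K L (φ (c * x))) * y) = 0 := fun y => by
    rw [sub_mul, map_sub, h1, ← Algebra.smul_def, map_smul, smul_eq_mul, mul_comm, sub_self]
  have h4 := h3 ((c - algebraMap K L (φ (c * x)))⁻¹ * x)
  rw [mul_inv_cancel_left₀ (sub_ne_zero.2 (hc _).symm), hx] at h4
  exact one_ne_zero h4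

/-- Singer difference sets are difference sets. -/
theorem isDifferenceSet_singerSet [Finite K] [Finite L] {φ : Module.Dual K L} (hφ : φ ≠ 0) :
    IsDifferenceSet (singerSet K (LinearMap.ker φ)) := by
  have : Module.Finite K L := Module.Finite.of_finite
  refine isDifferenceSet_iff.2
    ⟨(Nat.card K ^ (Module.finrank K L - 2) - 1) / (Nat.card K - 1), fun g hg => ?_⟩
  obtain ⟨c, hc⟩ := QuotientGroup.mk_surjective g.toMul
  obtain rfl : Additive.ofMul (c : Lˣ ⧸ (Units.map (algebraMap K L : K →* L)).range) = g :=
    congrArg Additive.ofMul hc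
  have hcK : ∀ k : K, algebraMap K L k ≠ (c : L) := fun k hk => hg <| by
    have hk0 : k ≠ 0 := fun h => c.ne_zero (by rw [← hk, h, map_zero])
    refine congrArg Additive.ofMul ((QuotientGroup.eq_one_iff c).2 ⟨Units.mk0 k hk0, Units.ext hk⟩)
  set ψ : Module.Dual K L := φ ∘ₗ LinearMap.mulLeft K (c : L)
  have hψ : ψ ≠ 0 := fun h => hφ <| LinearMap.ext fun y => by
    have := LinearMap.congr_fun h ((c : L)⁻¹ * y)
    simpa [ψ] using this
  have hinf := (finrank_inf_add_two_of_ne (Module.Dual.finrank_ker_add_one_of_ne_zero hφ)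
    (Module.Dual.finrank_ker_add_one_of_ne_zero hψ) (ker_comp_mulLeft_ne hφ hcK)).1
  -- Translation by the class of `c` is multiplication by `c`, so the overlap is the projective
  -- point set of an intersection of two distinct hyperplanes, of codimension two.
  have hset : {y | y ∈ singerSet K (LinearMap.ker φ) ∧ y + Additive.ofMul
      (c : Lˣ ⧸ (Units.map (algebraMap K L : K →* L)).range) ∈ singerSet K (LinearMap.ker φ)} =
      singerSet K (LinearMap.ker φ ⊓ LinearMap.ker ψ) := by
    ext y
    obtain ⟨u, hu⟩ := QuotientGroup.mk_surjective y.toMul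
    obtain rfl : Additive.ofMul (u : Lˣ ⧸ (Units.map (algebraMap K L : K →* L)).range) = y :=
      congrArg Additive.ofMul hu
    rw [Set.mem_ofPred_eq, ← ofMul_mul, ← QuotientGroup.mk_mul, ofMul_mem_singerSet_iff,
      ofMul_mem_singerSet_iff, ofMul_mem_singerSet_iff, Submodule.mem_inf, Units.val_mul, mul_comm]
    rfl
  have hq : 0 < Nat.card K - 1 := by
    have : 1 < Nat.card K := Finite.one_lt_card
    omega
  have hcard := ncard_singerSet_mul (LinearMap.ker φ ⊓ LinearMap.ker ψ)
  rw [hset, ← Nat.eq_sub_of_add_eq hinf, ← hcard, Nat.mul_div_cancel _ hq]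

/-- A hyperplane of `L` that contains an intermediate field `M` over which `L` has degree two
yields, through the complement of its Singer difference set, a harmonic ETF that is a disjoint
union of regular simplices. -/
theorem yieldsHarmonicETFOfSimplices_singerSet_compl {M : Type*} [Field M] [Algebra K M]
    [Algebra M L] [IsScalarTower K M L] [Finite K] [Finite L] {q f : ℕ} (hK : Nat.card K = q)
    (hf : 0 < f) (hM : Module.finrank K M = f) (hL : Module.finrank K L = 2 * f)
    {φ : Module.Dual K L} (hφ : φ ≠ 0) (hφM : ∀ m : M, φ (algebraMap M L m) = 0) :
    YieldsHarmonicETFOfSimplices (singerSet K (LinearMap.ker φ))ᶜ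
      (q ^ (2 * f - 1)) ((q ^ (2 * f) - 1) / (q - 1)) ((q ^ f - 1) / (q - 1)) (q ^ f) := by
  have : Module.Finite K L := Module.Finite.of_finite
  have hq : 1 < q := hK ▸ Finite.one_lt_card
  have hq1 : 0 < q - 1 := by omega
  have hker : Module.finrank K (LinearMap.ker φ) = 2 * f - 1 := by
    have := Module.Dual.finrank_ker_add_one_of_ne_zero hφ
    omega
  let W : Submodule K L := LinearMap.range (IsScalarTower.toAlgHom K M L).toLinearMap
  have hW : Module.finrank K W = f := by
    rw [← hM]
    exact LinearMap.finrank_range_of_inj (algebraMap M L).injective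
  let P : Subgroup Lˣ := (Units.map (algebraMap K L : K →* L)).range
  -- `H` is the image of `Mˣ`. As a set it consists of the projective points of `M`, hence lies in
  -- the Singer set of any hyperplane containing `M`.
  let H : AddSubgroup (SingerGroup K L) := Subgroup.toAddSubgroup
    ((Units.map (algebraMap M L : M →* L)).range.map (QuotientGroup.mk' P))
  have hH : (H : Set (SingerGroup K L)) = singerSet K W := by
    ext g
    constructor
    · rintro ⟨_, ⟨m, rfl⟩, hg⟩
      exact ⟨_, ⟨m, rfl⟩, congrArg Additive.ofMul hg.symm⟩
    · rintro ⟨u, ⟨m, hm⟩, rfl⟩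
      have hm0 : m ≠ 0 := fun h => u.ne_zero (by rw [← hm, h, map_zero])
      exact ⟨u, ⟨Units.mk0 m hm0, Units.ext hm⟩, rfl⟩
  have hN := natCard_singerGroup_mul (K := K) (L := L)
  have hD := ncard_singerSet_mul (LinearMap.ker φ)
  have hV := ncard_singerSet_mul W
  rw [hK, hL] at hN
  rw [hK, hker] at hD
  rw [hK, hW] at hV
  have hDc := Set.ncard_add_ncard_compl (singerSet K (LinearMap.ker φ))
  have hpow : q ^ (2 * f) = q ^ (2 * f - 1) * q := by
    rw [← pow_succ]
    congr 1
    omega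
  have hpos : 0 < q ^ (2 * f - 1) := by positivity
  have hd : (singerSet K (LinearMap.ker φ))ᶜ.ncard = q ^ (2 * f - 1) := by
    refine Nat.eq_of_mul_eq_mul_right hq1 ?_
    rw [Nat.eq_sub_of_add_eq' hDc, Nat.sub_mul, hN, hD, Nat.mul_sub, ← hpow, mul_one]
    omega
  rw [← hN, ← hV, Nat.mul_div_cancel _ hq1, Nat.mul_div_cancel _ hq1]
  refine yieldsHarmonicETFOfSimplices_of_disjoint (isDifferenceSet_singerSet hφ).compl H ?_ rfl hd
    ?_ hpos (by positivity) ?_ ?_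
  · intro x hx hxH
    have hx' : x ∈ singerSet K W := hH ▸ hxH
    obtain ⟨u, ⟨m, hm⟩, rfl⟩ := hx'
    exact hx ⟨u, by rw [LinearMap.mem_ker, ← hm]; exact hφM m, rfl⟩
  · rw [← hH]
    rfl
  -- The index of `H` is `q ^ f + 1`, from q^(2f) - 1 = (q^f - 1)(q^f + 1).
  · refine Nat.eq_of_mul_eq_mul_right hq1 ?_
    have h := Nat.sq_sub_sq (q ^ f) 1
    rw [one_pow, ← pow_mul, mul_comm f] at h
    rw [hN, mul_right_comm, hV, h, mul_comm]
  · have hN' : (Nat.card (SingerGroup K L) : ℝ) * (q - 1) = q ^ (2 * f) - 1 := by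
      have h : ((q - 1 : ℕ) : ℝ) = q - 1 := by push_cast [hq.le]; ring
      have h' : ((q ^ (2 * f) - 1 : ℕ) : ℝ) = q ^ (2 * f) - 1 := by
        rw [Nat.cast_sub (Nat.one_le_pow _ _ (by omega))]
        push_cast
        ring
      rw [← h, ← h', ← hN]
      push_cast
      ring
    have hpow' : (q : ℝ) ^ (2 * f) = q ^ (2 * f - 1) * q := by exact_mod_cast hpow
    have hsq : ((q ^ f : ℕ) : ℝ) ^ 2 = q ^ (2 * f - 1) * q := by
      rw [← hpow']
      push_cast
      ring
    rw [hsq]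
    rw [hpow'] at hN'
    push_cast
    linear_combination (q : ℝ) ^ (2 * f - 1) * hN'

end Singer

/-! ### Construction of the fields and assembly of the three cases. -/

/-- Harmonic ETFs from the complements of Singer, from McFarland, and from the complements of twin
prime power difference sets that are disjoint unions of regular simplices. -/
theorem mainTheorem8 (q : ℕ) (hq : IsPrimePow q) :
    -- (a) complements of Singer difference sets
    (∀ f : ℕ, 2 ≤ f →
      ∃ (K L : Type) (_ : Field K) (_ : Field L) (_ : Algebra K L) (T : Submodule K L),
        Nat.card K = q ∧ Module.finrank K L = 2 * f ∧ Module.finrank K T = 2 * f - 1 ∧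
        YieldsHarmonicETFOfSimplices (singerSet K T)ᶜ
          (q ^ (2 * f - 1))
          ((q ^ (2 * f) - 1) / (q - 1))
          ((q ^ f - 1) / (q - 1))
          (q ^ f)) ∧
    -- (b) McFarland difference sets
    (∀ e : ℕ, 1 ≤ e →
      ∃ (F A : Type) (_ : Field F) (_ : AddCommGroup A) (t : Hyperplane F e → A),
        Nat.card F = q ∧ Nat.card A = (q ^ (e + 1) - 1) / (q - 1) + 1 ∧ Function.Injective t ∧
        YieldsHarmonicETFOfSimplices (mcFarlandSet t)
          (q ^ e * ((q ^ (e + 1) - 1) / (q - 1)))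
          (q ^ (e + 1) * (1 + (q ^ (e + 1) - 1) / (q - 1)))
          (q ^ (e + 1))
          ((q ^ (e + 1) - 1) / (q - 1))) ∧
    -- (c) complements of twin prime power difference sets
    (IsPrimePow (q + 2) → Odd (q + 2) →
      ∃ (K L : Type) (_ : Field K) (_ : Field L),
        Nat.card K = q ∧ Nat.card L = q + 2 ∧
        YieldsHarmonicETFOfSimplices (twinPrimePowerSet K L)ᶜ
          ((q + 1) ^ 2 / 2)
          (q * (q + 2))
          q
          (q + 1)) := by
  obtain ⟨p, k, hp, hk, rfl⟩ := (isPrimePow_nat_iff q).1 hq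
  have := Fact.mk hp
  let K := GaloisField p k
  have hK : Nat.card K = p ^ k := GaloisField.card p k hk.ne'
  refine ⟨fun f hf => ?_, fun e he => ?_, fun hq2 hodd => ?_⟩
  · have : NeZero f := ⟨by omega⟩
    -- `L` is built as a tower of degrees `f` and 2, so that `M` is an intermediate field by
    -- construction.
    let M := FiniteField.Extension K p f
    have : CharP M p := charP_of_injective_algebraMap (algebraMap K M).injective p
    let L := FiniteField.Extension M p 2
    let algKL : Algebra K L := ((algebraMap M L).comp (algebraMap K M)).toAlgebra
    have : IsScalarTower K M L := IsScalarTower.of_algebraMap_eq fun _ => rfl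
    have hM : Module.finrank K M = f := FiniteField.finrank_extension K p f
    have hML : Module.finrank M L = 2 := FiniteField.finrank_extension M p 2
    have hL : Module.finrank K L = 2 * f := by
      rw [← Module.finrank_mul_finrank K M L, hM, hML, mul_comm]
    have : Finite M := Module.finite_of_finite K
    have : Finite L := Module.finite_of_finite M
    -- `M` has dimension `f < 2 * f` over `K`, so some hyperplane `ker φ` of `L` contains it.
    have hlt : LinearMap.range (IsScalarTower.toAlgHom K M L).toLinearMap < ⊤ := by
      refine lt_top_iff_ne_top.2 fun h => ?_
      have h1 : Module.finrank K (LinearMap.range (IsScalarTower.toAlgHom K M L).toLinearMap) =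
          Module.finrank K M := LinearMap.finrank_range_of_inj (algebraMap M L).injective
      rw [h, finrank_top] at h1
      omega
    obtain ⟨φ, hφ, hle⟩ := Submodule.exists_le_ker_of_lt_top _ hlt
    refine ⟨K, L, inferInstance, inferInstance, algKL, LinearMap.ker φ, hK, hL, ?_,
      yieldsHarmonicETFOfSimplices_singerSet_compl (M := M) hK (by omega) hM hL hφ
        fun m => hle ⟨m, rfl⟩⟩
    have : Module.Finite K L := Module.Finite.of_finite
    have := Module.Dual.finrank_ker_add_one_of_ne_zero hφ
    omega
  · obtain ⟨A, _, t, h⟩ := exists_yieldsHarmonicETFOfSimplices_mcFarlandSet K hK he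
    exact ⟨K, A, inferInstance, inferInstance, t, hK, h⟩
  · obtain ⟨r, l, hr, hl, hrl⟩ := (isPrimePow_nat_iff _).1 hq2
    have := Fact.mk hr
    have hL : Nat.card (GaloisField r l) = p ^ k + 2 := (GaloisField.card r l hl.ne').trans hrl
    refine ⟨K, GaloisField r l, inferInstance, inferInstance, hK, hL,
      yieldsHarmonicETFOfSimplices_twinPrimePowerSet_compl hK hL ?_⟩
    obtain ⟨j, hj⟩ := hodd
    exact ⟨j - 1, by omega⟩
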